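/- Let $(W,R)$ be a frame with $W$ countable and $R$ an equivalence relation (an $\mathsf{S5}$ frame), let $L$ be a finite set, and let $\Omega=(\{0,1\}^L)^W$ be the space of valuations $V\colon W\to\{0,1\}^L$ with the product $\sigma$-field. Fix $w_0\in W$, and let $G$ be the group of all bijections $\pi\colon W\to W$ with $R(w,v)\iff R(\pi(w),\pi(v))$ for all $w,v\in W$ and with $\pi(w_0)=w_0$. It acts on $\Omega$ by $(\pi\cdot V)(w)=V(\pi^{-1}(w))$. Suppose that the accessible cluster $\{w\in W: R(w_0,w)\}$ is infinite, and put $C=\{w\in W: R(w_0,w),\ w\neq w_0\}$. Assume: 1. (point-homogeneity at $w_0$) for all $v,v'\in C$ there is $\pi\in G$ with $\pi(v)=v'$; 2. (Ext) for all finite $F_1,\dots,F_m\subseteq C$, pairwise disjoint, and finite $F'_1,\dots,F'_m\subseteq C$, pairwise disjoint, with $|F_i|=|F'_i|$ for all $i$, there is $\pi\in G$ with $\pi(F_i)=F'_i$ for all $i$. Let $P$ be a probability measure on $\Omega$ that is modally exchangeable at $w_0$, that is, $P(\pi^{-1}(A))=P(A)$ for all $\pi\in G$ and all measurable $A\subseteq\Omega$,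 where $\pi^{-1}(A)=\{V:\pi\cdot V\in A\}$. Then there is a probability measure $\mu$ on the space $\mathcal M(\{0,1\}^L)$ of probability measures on $\{0,1\}^L$ such that, for every measurable $A\subseteq(\{0,1\}^L)^C$, the function $\Lambda\mapsto P_\Lambda(A)$ is measurable and $$P\bigl(V|_C\in A\bigr)=\int_{\mathcal M(\{0,1\}^L)}P_\Lambda(A)\,\mu(d\Lambda),$$ where $P_\Lambda=\Lambda^{\otimes C}$ is the product law under which the valuations $V(w)$, $w\in C$, are i.i.d. with common law $\Lambda$. -/

import Mathlib

open MeasureTheory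

/-- The group of automorphisms of the frame `(W, R)`: bijections `π` of `W` with
`R (π w) (π v) ↔ R w v`. -/
abbrev FrameAut {W : Type*} (R : W → W → Prop) : Type _ := R ≃r R

/-- The stabilizer of the world `w₀` in the automorphism group of the frame. -/
def worldStabilizer {W : Type*} (R : W → W → Prop) (w₀ : W) : Subgroup (FrameAut R) where
  carrier := {π | π w₀ = w₀}
  one_mem' := rfl
  mul_mem' := by
    intro π σ hπ hσ
    change π (σ w₀) = w₀
    rw [show σ w₀ = w₀ from hσ, show π w₀ = w₀ from hπ]
  inv_mem' := by
    intro π hπ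
    change π.symm w₀ = w₀
    rw [RelIso.symm_apply_eq]
    exact (show π w₀ = w₀ from hπ).symm

/-- The accessible cluster of `w₀`: all worlds accessible from `w₀`. -/
def accessibleCluster {W : Type*} (R : W → W → Prop) (w₀ : W) : Set W :=
  {w | R w₀ w}

/-- The accessible worlds other than the reference world `w₀` itself. In a reflexive frame `w₀` lies
in its own accessible cluster and is fixed by the stabilizer, so these are the worlds that the
stabilizer can permute transitively. -/
def properCluster {W : Type*} (R : W → W → Prop) (w₀ : W) : Set W :=
  accessibleCluster R w₀ \ {w₀}

/-- The space of valuations on a set `W` of worlds, `({0,1}^L)^W`, with the product σ-field. -/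
abbrev ValuationSpace (W L : Type*) : Type _ := W → (L → Bool)

/-- The action of automorphisms on valuations: `(π · V)(w) = V(π⁻¹ w)`. -/
def actOnValuation {W L : Type*} {R : W → W → Prop} (π : FrameAut R)
    (V : ValuationSpace W L) : ValuationSpace W L :=
  fun w => V (π⁻¹ w)

/-- Modal exchangeability at `w₀`: invariance of the measure under the stabilizer of `w₀`. -/
def ModallyExchangeable {W L : Type*} (R : W → W → Prop) (w₀ : W)
    (P : Measure (ValuationSpace W L)) : Prop :=
  ∀ π ∈ worldStabilizer R w₀, ∀ A : Set (ValuationSpace W L), MeasurableSet A →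
    P (actOnValuation π ⁻¹' A) = P A

/-- Point-homogeneity at `w₀`: the accessible worlds other than `w₀` form a single orbit
of the stabilizer of `w₀`. -/
def PointHomogeneousAt {W : Type*} (R : W → W → Prop) (w₀ : W) : Prop :=
  ∀ v ∈ properCluster R w₀, ∀ v' ∈ properCluster R w₀, ∃ π ∈ worldStabilizer R w₀, π v = v'

/-- The finite-support extension property (Ext) of the stabilizer of `w₀`: two finite families of
pairwise disjoint finite sets of accessible worlds (other than `w₀`), with equal cardinalities,
are matched by an element of the stabilizer. -/
def ExtensionProperty {W : Type*} (R : W → W → Prop) (w₀ : W) : Prop :=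
  ∀ (m : ℕ) (F F' : Fin m → Finset W),
    (∀ i, (F i : Set W) ⊆ properCluster R w₀) →
    (∀ i, (F' i : Set W) ⊆ properCluster R w₀) →
    Pairwise (fun i j => Disjoint (F i) (F j)) →
    Pairwise (fun i j => Disjoint (F' i) (F' j)) →
    (∀ i, (F i).card = (F' i).card) →
    ∃ π ∈ worldStabilizer R w₀, ∀ i, π '' (F i : Set W) = (F' i : Set W)

/-- The product law on valuations of a set `C` of worlds under which the valuations `V w`,
`w ∈ C`, are independent and identically distributed with law `Λ`. -/
noncomputable def iidLaw {W L : Type*} (C : Set W) (Λ : ProbabilityMeasure (L → Bool)) :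
    Measure (ValuationSpace C L) :=
  Measure.infinitePi (fun _ : C => (Λ : Measure (L → Bool)))

/-! Applied to singletons, (Ext) moves any finite tuple of distinct worlds of the proper cluster to
any other, so modal exchangeability makes the restricted valuation an infinite exchangeable family
with values in the finite set `L → Bool`. The claim is then de Finetti's theorem.

The latter is proved by moments. A product of empirical frequencies averages over samples drawn with
replacement; repetitions become negligible, so its expectation tends to the corresponding cylinder
probability (`tendsto_integral_prod_empiricalDistribution`). The simplex is compact, so the laws of
the empirical distributions have a limit point `ν` (`exists_integral_eq_of_tendsto`). Its moments
are the cylinder probabilities, and cylinders determine the measure (`eq_bind_infinitePi_const`). -/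

open Filter Topology

/-! ### Laws on a finite set as points of the simplex -/

section SimplexMeasure

variable {S : Type*} [Fintype S]

lemma continuous_sum_indicator_mul (t : Set S) :
    Continuous fun p : stdSimplex ℝ S => ∑ s, t.indicator 1 s * p s :=
  continuous_finsetSum _ fun s _ =>
    continuous_const.mul ((continuous_apply s).comp continuous_subtype_val)

variable [MeasurableSpace S]

/-- The probability measure on a finite space with given point masses. -/
noncomputable def simplexMeasure (p : stdSimplex ℝ S) : ProbabilityMeasure S :=
  ⟨∑ s, ENNReal.ofReal (p s) • Measure.dirac s, ⟨by
    simp only [Measure.coe_finsetSum, Measure.coe_smul, Finset.sum_apply, Pi.smul_apply,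
      measure_univ, smul_eq_mul, mul_one]
    have h := ENNReal.ofReal_sum_of_nonneg (s := Finset.univ) (f := p) fun s _ => p.2.1 s
    rw [← h]
    exact (congrArg ENNReal.ofReal p.2.2).trans ENNReal.ofReal_one⟩⟩

lemma simplexMeasure_apply (p : stdSimplex ℝ S) {t : Set S} (ht : MeasurableSet t) :
    (simplexMeasure p : Measure S) t = ENNReal.ofReal (∑ s, t.indicator 1 s * p s) := by
  classical
  rw [ENNReal.ofReal_sum_of_nonneg (f := fun s => t.indicator (1 : S → ℝ) s * p s) fun s _ =>
    mul_nonneg (Set.indicator_nonneg (fun _ _ => zero_le_one) s) (p.2.1 s)]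
  simp only [simplexMeasure, ProbabilityMeasure.coe_mk, Measure.coe_finsetSum, Measure.coe_smul,
    Finset.sum_apply, Pi.smul_apply, smul_eq_mul, Measure.dirac_apply' _ ht]
  refine Finset.sum_congr rfl fun s _ => ?_
  by_cases h : s ∈ t <;> simp [h]

lemma measurable_simplexMeasure : Measurable (simplexMeasure (S := S)) := by
  refine Measurable.subtype_mk (Measure.measurable_of_measurable_coe _ fun t ht => ?_)
  have := (continuous_sum_indicator_mul t).measurable.ennreal_ofReal
  convert this using 2 with p
  exact simplexMeasure_apply p ht

end SimplexMeasure

/-! ### Empirical distributions -/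

section Empirical

variable {S : Type*} [Fintype S]

/-- The empirical distribution of the first `n + 1` terms of a sequence. -/
noncomputable def empiricalDistribution (n : ℕ) (x : ℕ → S) : stdSimplex ℝ S :=
  ⟨fun s => (n + 1 : ℝ)⁻¹ * ∑ i : Fin (n + 1), Set.indicator {s} 1 (x i), by
    classical
    refine ⟨fun s => mul_nonneg (by positivity) (Finset.sum_nonneg fun i _ =>
      Set.indicator_nonneg (fun _ _ => zero_le_one) _), ?_⟩
    rw [← Finset.mul_sum, Finset.sum_comm]
    have : (n + 1 : ℝ) ≠ 0 := by positivity
    simp [Set.indicator_apply, this]⟩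

lemma sum_indicator_mul_empiricalDistribution (n : ℕ) (x : ℕ → S) (t : Set S) :
    ∑ s, t.indicator 1 s * empiricalDistribution n x s =
      (n + 1 : ℝ)⁻¹ * ∑ i : Fin (n + 1), t.indicator 1 (x i) := by
  classical
  change ∑ s, t.indicator 1 s *
    ((n + 1 : ℝ)⁻¹ * ∑ i : Fin (n + 1), Set.indicator {s} 1 (x i)) = _
  simp_rw [mul_left_comm _ (n + 1 : ℝ)⁻¹, ← Finset.mul_sum, Finset.mul_sum]
  rw [Finset.sum_comm]
  simp [Set.indicator_apply, Finset.sum_ite, mul_comm]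

lemma measurable_empiricalDistribution [MeasurableSpace S] [MeasurableSingletonClass S] (n : ℕ) :
    Measurable (empiricalDistribution (S := S) n) := by
  refine Measurable.subtype_mk (measurable_pi_lambda _ fun s => ?_)
  exact measurable_const.mul (Finset.measurable_sum _ fun i _ =>
    (measurable_one.indicator (measurableSet_singleton s)).comp (measurable_pi_apply _))

end Empirical

/-! ### Rarity of repetitions and weak limits -/

lemma tendsto_card_embedding_div_card_fun (J : Type*) [Fintype J] :
    Tendsto (fun n : ℕ => (Fintype.card (J ↪ Fin (n + 1)) : ℝ) / (n + 1) ^ Fintype.card J)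
      atTop (𝓝 1) := by
  set k := Fintype.card J
  have hlow : Tendsto (fun n : ℕ => (1 - (k : ℝ) / ((n : ℝ) + 1)) ^ k) atTop (𝓝 1) := by
    have h := (tendsto_one_div_add_atTop_nhds_zero_nat (𝕜 := ℝ)).const_mul (k : ℝ)
    simpa [div_eq_mul_inv] using (h.const_sub 1).pow k
  -- The falling factorial lies between `(n + 1 - k) ^ k` and `(n + 1) ^ k`; the lower bound is used
  -- for `n ≥ k`, where the base is nonnegative.
  refine tendsto_of_tendsto_of_tendsto_of_le_of_le' hlow tendsto_const_nhds ?_ ?_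
  · filter_upwards [eventually_ge_atTop k] with n hn
    have hpos : (0 : ℝ) < n + 1 := by positivity
    rw [one_sub_div hpos.ne', div_pow, Fintype.card_embedding_eq, Fintype.card_fin]
    gcongr
    calc ((n : ℝ) + 1 - k) ^ k ≤ ((n + 1 + 1 - k : ℕ) : ℝ) ^ k := by
          rw [Nat.cast_sub (by omega)]
          push_cast
          have : (k : ℝ) ≤ n := by exact_mod_cast hn
          gcongr
          · linarith
          · linarith
      _ ≤ _ := by exact_mod_cast Nat.pow_sub_le_descFactorial (n + 1) k
  · refine Eventually.of_forall fun n => div_le_one_of_le₀ ?_ (by positivity)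
    rw [Fintype.card_embedding_eq, Fintype.card_fin]
    exact_mod_cast Nat.descFactorial_le_pow (n + 1) k

/-- By compactness, a sequence of probability measures has a probability measure that integrates
every continuous function to the limit of its integrals, whenever that limit exists. -/
lemma exists_integral_eq_of_tendsto {K : Type*} [TopologicalSpace K] [CompactSpace K] [T2Space K]
    [MeasurableSpace K] [BorelSpace K] (ν : ℕ → ProbabilityMeasure K) :
    ∃ ν' : ProbabilityMeasure K, ∀ (F : C(K, ℝ)) (c : ℝ),
      Tendsto (fun n => ∫ p, F p ∂(ν n : Measure K)) atTop (𝓝 c) →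
        ∫ p, F p ∂(ν' : Measure K) = c := by
  -- A limit along a nonprincipal ultrafilter replaces a convergent subsequence; as the ultrafilter
  -- refines `atTop`, limits that already exist are kept.
  obtain ⟨ν', -, hν'⟩ := isCompact_univ.ultrafilter_le_nhds ((hyperfilter ℕ).map ν) (by simp)
  have hlim : Tendsto ν (hyperfilter ℕ) (𝓝 ν') := hν'
  exact ⟨ν', fun F c hc => tendsto_nhds_unique
    (ProbabilityMeasure.tendsto_iff_forall_integral_tendsto.1 hlim
      (BoundedContinuousFunction.mkOfCompact F)) (hc.mono_left Nat.hyperfilter_le_atTop)⟩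

/-! ### Mixtures of product laws -/

section ProductLaw

variable {C S : Type*} [MeasurableSpace S]

/-- On a cylinder the product law is a finite product of evaluations of `Λ`, and cylinders form a
generating π-system. -/
lemma measurable_infinitePi_const :
    Measurable fun Λ : ProbabilityMeasure S => Measure.infinitePi fun _ : C => (Λ : Measure S) := by
  refine Measurable.measure_of_isPiSystem_of_isProbabilityMeasure
    (generateFrom_squareCylinders (α := fun _ : C => S)).symm
    (isPiSystem_squareCylinders (fun _ => MeasurableSpace.isPiSystem_measurableSet)
      fun _ => MeasurableSet.univ) ?_
  rintro _ ⟨I, t, ht, rfl⟩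
  have ht' : ∀ i, MeasurableSet (t i) := fun i => ht i (Set.mem_univ i)
  simp_rw [Measure.infinitePi_pi _ fun i _ => ht' i]
  exact Finset.measurable_prod _ fun i _ =>
    (Measure.measurable_coe (ht' i)).comp measurable_subtype_coe

lemma eq_bind_infinitePi_const {Q : Measure (C → S)} [IsProbabilityMeasure Q]
    {μ : Measure (ProbabilityMeasure S)} [IsProbabilityMeasure μ]
    (h : ∀ (I : Finset C) (t : C → Set S), (∀ i, MeasurableSet (t i)) →
      Q (Set.pi I t) = ∫⁻ Λ, ∏ i ∈ I, (Λ : Measure S) (t i) ∂μ) :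
    Q = μ.bind fun Λ => Measure.infinitePi fun _ : C => (Λ : Measure S) := by
  refine ext_of_generate_finite _ (generateFrom_squareCylinders (α := fun _ : C => S)).symm
    (isPiSystem_squareCylinders (fun _ => MeasurableSpace.isPiSystem_measurableSet)
      fun _ => MeasurableSet.univ) ?_ ?_
  · rintro _ ⟨I, t, ht, rfl⟩
    have ht' : ∀ i, MeasurableSet (t i) := fun i => ht i (Set.mem_univ i)
    rw [Measure.bind_apply (MeasurableSet.pi I.countable_toSet fun i _ => ht' i)
      measurable_infinitePi_const.aemeasurable, h I t ht']
    simp_rw [Measure.infinitePi_pi _ fun i _ => ht' i]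
  · rw [Measure.bind_apply MeasurableSet.univ measurable_infinitePi_const.aemeasurable]
    simp

end ProductLaw

/-! ### De Finetti's theorem by moments -/

section DeFinetti

variable {S : Type*} [Fintype S] [MeasurableSpace S] [MeasurableSingletonClass S]

/-- Expanding a product of averages gives one term for each choice of indices, repetitions allowed.
-/
lemma integral_prod_empiricalDistribution {Ω J : Type*} [MeasurableSpace Ω] [Fintype J]
    [DecidableEq J]
    (Q : Measure Ω) [IsProbabilityMeasure Q] {X : ℕ → Ω → S} (hX : ∀ i, Measurable (X i))
    (t : J → Set S) (n : ℕ) :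
    ∫ ω, ∏ j, ∑ s, (t j).indicator 1 s * empiricalDistribution n (fun i => X i ω) s ∂Q =
      (∑ f : J → Fin (n + 1), Q.real {ω | ∀ j, X (f j) ω ∈ t j}) / (n + 1) ^ Fintype.card J := by
  classical
  have hm (f : J → Fin (n + 1)) : MeasurableSet {ω | ∀ j, X (f j) ω ∈ t j} := by
    rw [Set.ofPred_forall]
    exact MeasurableSet.iInter fun j => hX _ (Set.toFinite (t j)).measurableSet
  have h (ω : Ω) : ∏ j, ∑ s, (t j).indicator 1 s * empiricalDistribution n (fun i => X i ω) s =
      (∑ f : J → Fin (n + 1), {ω | ∀ j, X (f j) ω ∈ t j}.indicator (1 : Ω → ℝ) ω) /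
        (n + 1) ^ Fintype.card J := by
    simp_rw [sum_indicator_mul_empiricalDistribution]
    rw [Finset.prod_mul_distrib, Finset.prod_univ_sum, Finset.prod_const, Finset.card_univ,
      Fintype.piFinset_univ, div_eq_inv_mul, inv_pow]
    congr 1
    refine Finset.sum_congr rfl fun f _ => ?_
    simp [Set.indicator_apply, Finset.prod_ite_zero]
  simp_rw [h]
  rw [integral_div, integral_finsetSum _ fun f _ =>
    (integrable_const (1 : ℝ)).indicator (hm f) (f := (1 : Ω → ℝ))]
  simp_rw [integral_indicator_one (hm _)]

/-- Moments of the empirical distributions of an exchangeable sequence converge to the joint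
probabilities. -/
lemma tendsto_integral_prod_empiricalDistribution {Ω J : Type*} [MeasurableSpace Ω] [Fintype J]
    [DecidableEq J]
    (Q : Measure Ω) [IsProbabilityMeasure Q] {X : ℕ → Ω → S} (hX : ∀ i, Measurable (X i))
    (t : J → Set S) {c : ℝ}
    (hc : ∀ f : J ↪ ℕ, Q.real {ω | ∀ j, X (f j) ω ∈ t j} = c) :
    Tendsto (fun n => ∫ ω, ∏ j, ∑ s, (t j).indicator 1 s *
      empiricalDistribution n (fun i => X i ω) s ∂Q) atTop (𝓝 c) := by
  classical
  have hr := tendsto_card_embedding_div_card_fun J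
  simp_rw [integral_prod_empiricalDistribution Q hX t]
  set a : ∀ n, (J → Fin (n + 1)) → ℝ := fun n f => Q.real {ω | ∀ j, X (f j) ω ∈ t j}
  -- By exchangeability each injective choice contributes exactly `c`.
  have hsplit (n : ℕ) : ∑ f, a n f = Fintype.card (J ↪ Fin (n + 1)) * c +
      ∑ f with ¬ Function.Injective f, a n f := by
    rw [← Finset.sum_filter_add_sum_filter_not Finset.univ Function.Injective]
    congr 1
    rw [Finset.sum_congr rfl (g := fun _ => c), Finset.sum_const, nsmul_eq_mul,
      Fintype.card_congr (Equiv.subtypeInjectiveEquivEmbedding J (Fin (n + 1))).symm,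
      Fintype.card_subtype]
    intro f hf
    exact hc ⟨fun j => f j, Fin.val_injective.comp (Finset.mem_filter.1 hf).2⟩
  have hcard (n : ℕ) : ((Finset.univ.filter
      fun f : J → Fin (n + 1) => ¬ Function.Injective f).card : ℝ) =
      (n + 1) ^ Fintype.card J - Fintype.card (J ↪ Fin (n + 1)) := by
    have h := Finset.card_filter_add_card_filter_not (s := Finset.univ)
      (fun f : J → Fin (n + 1) => Function.Injective f)
    rw [← Fintype.card_subtype, Fintype.card_congr
      (Equiv.subtypeInjectiveEquivEmbedding J (Fin (n + 1))), Finset.card_univ,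
      Fintype.card_fun, Fintype.card_fin] at h
    rw [eq_sub_iff_add_eq']
    exact_mod_cast h
  have hlim : Tendsto (fun n : ℕ => (Fintype.card (J ↪ Fin (n + 1)) : ℝ) /
      (n + 1) ^ Fintype.card J * c) atTop (𝓝 c) := by
    simpa using hr.mul_const c
  have hlim' : Tendsto (fun n : ℕ => (Fintype.card (J ↪ Fin (n + 1)) : ℝ) /
      (n + 1) ^ Fintype.card J * c + (1 - (Fintype.card (J ↪ Fin (n + 1)) : ℝ) /
      (n + 1) ^ Fintype.card J)) atTop (𝓝 c) := by
    simpa using hlim.add (hr.const_sub 1)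
  -- Each non-injective term lies in `[0, 1]`, so together they contribute at most the proportion of
  -- non-injective choices, which vanishes.
  refine tendsto_of_tendsto_of_tendsto_of_le_of_le hlim hlim' (fun n => ?_) fun n => ?_
  · change _ ≤ (∑ f, a n f) / _
    rw [hsplit, add_div, mul_div_right_comm]
    exact le_add_of_nonneg_right
      (div_nonneg (Finset.sum_nonneg fun f _ => measureReal_nonneg) (by positivity))
  · change (∑ f, a n f) / _ ≤ _
    have hpos : (0 : ℝ) < (n + 1) ^ Fintype.card J := by positivity
    have hone : 1 - (Fintype.card (J ↪ Fin (n + 1)) : ℝ) / (n + 1) ^ Fintype.card J =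
        ((n + 1) ^ Fintype.card J - Fintype.card (J ↪ Fin (n + 1))) / (n + 1) ^ Fintype.card J := by
      rw [sub_div, div_self hpos.ne']
    rw [hsplit, add_div, mul_div_right_comm, hone, ← hcard]
    gcongr
    simpa using Finset.sum_le_card_nsmul _ (a n) 1 fun f _ => measureReal_le_one

/-- Joint moments of a mixture of i.i.d. laws in terms of the point masses. -/
lemma lintegral_prod_map_simplexMeasure (ν : Measure (stdSimplex ℝ S)) [IsFiniteMeasure ν]
    {C : Type*} (I : Finset C) (t : C → Set S) :
    ∫⁻ Λ, ∏ i ∈ I, (Λ : Measure S) (t i) ∂(ν.map simplexMeasure) =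
      ENNReal.ofReal (∫ p, ∏ i ∈ I, ∑ s, (t i).indicator 1 s * p s ∂ν) := by
  have ht (i : C) : MeasurableSet (t i) := (Set.toFinite (t i)).measurableSet
  have h0 (p : stdSimplex ℝ S) (i : C) : 0 ≤ ∑ s, (t i).indicator 1 s * p s :=
    Finset.sum_nonneg fun s _ =>
      mul_nonneg (Set.indicator_nonneg (fun _ _ => zero_le_one) s) (p.2.1 s)
  have hcont : Continuous fun p : stdSimplex ℝ S => ∏ i ∈ I, ∑ s, (t i).indicator 1 s * p s :=
    continuous_finsetProd _ fun i _ => continuous_sum_indicator_mul (t i)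
  have hmeas : Measurable fun Λ : ProbabilityMeasure S => ∏ i ∈ I, (Λ : Measure S) (t i) :=
    Finset.measurable_prod _ fun i _ =>
      (Measure.measurable_coe (ht i)).comp measurable_subtype_coe
  rw [lintegral_map hmeas measurable_simplexMeasure,
    ofReal_integral_eq_lintegral_ofReal
      (hcont.integrable_of_hasCompactSupport (HasCompactSupport.of_compactSpace _))
      (Eventually.of_forall fun p => Finset.prod_nonneg fun i _ => h0 p i)]
  refine lintegral_congr fun p => ?_
  rw [ENNReal.ofReal_prod_of_nonneg fun i _ => h0 p i]
  exact Finset.prod_congr rfl fun i _ => simplexMeasure_apply p (ht i)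

/-- **de Finetti's theorem** for families of random variables with finitely many values: an
infinite exchangeable family is a mixture of i.i.d. families. -/
theorem exists_eq_bind_infinitePi_of_exchangeable {C : Type*} [Infinite C]
    (Q : Measure (C → S)) [IsProbabilityMeasure Q]
    (hQ : ∀ (I : Finset C) (f : I ↪ C) (t : I → Set S),
      Q {x | ∀ i, x (f i) ∈ t i} = Q {x | ∀ i : I, x i ∈ t i}) :
    ∃ μ : Measure (ProbabilityMeasure S), IsProbabilityMeasure μ ∧
      Q = μ.bind fun Λ => Measure.infinitePi fun _ : C => (Λ : Measure S) := by
  classical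
  -- One sequence of distinct indices suffices to build the mixing measure: exchangeability carries
  -- its joint laws to any finite `I`.
  obtain ⟨e⟩ : Nonempty (ℕ ↪ C) := ⟨Infinite.natEmbedding C⟩
  have hE (n : ℕ) : Measurable fun x : C → S => empiricalDistribution n fun i => x (e i) :=
    (measurable_empiricalDistribution n).comp
      (measurable_pi_lambda _ fun i => measurable_pi_apply (e i))
  have hmapprob (n : ℕ) :
      IsProbabilityMeasure (Q.map fun x => empiricalDistribution n fun i => x (e i)) :=
    Measure.isProbabilityMeasure_map (hE n).aemeasurable
  obtain ⟨ν, hν⟩ := exists_integral_eq_of_tendsto (K := stdSimplex ℝ S) fun n => ⟨_, hmapprob n⟩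
  have hprob : IsProbabilityMeasure ((ν : Measure (stdSimplex ℝ S)).map simplexMeasure) :=
    Measure.isProbabilityMeasure_map measurable_simplexMeasure.aemeasurable
  refine ⟨(ν : Measure (stdSimplex ℝ S)).map simplexMeasure, hprob,
    eq_bind_infinitePi_const fun I t ht => ?_⟩
  have hcont : Continuous fun p : stdSimplex ℝ S => ∏ i ∈ I, ∑ s, (t i).indicator 1 s * p s :=
    continuous_finsetProd _ fun i _ => continuous_sum_indicator_mul (t i)
  rw [lintegral_prod_map_simplexMeasure, ← ofReal_measureReal]
  refine congrArg ENNReal.ofReal (hν ⟨_, hcont⟩ _ ?_).symm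
  have hmap (n : ℕ) : ∫ p, ∏ i ∈ I, ∑ s, (t i).indicator 1 s * p s
      ∂(Q.map fun x => empiricalDistribution n fun i => x (e i)) =
        ∫ x, ∏ i : I, ∑ s, (t i).indicator 1 s *
          empiricalDistribution n (fun i => x (e i)) s ∂Q := by
    rw [integral_map (hE n).aemeasurable hcont.aestronglyMeasurable]
    refine integral_congr_ae (Eventually.of_forall fun x => ?_)
    exact (Finset.prod_coe_sort I _).symm
  simp only [ContinuousMap.coe_mk, ProbabilityMeasure.coe_mk, hmap]
  refine tendsto_integral_prod_empiricalDistribution Q (X := fun i x => x (e i))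
    (fun i => measurable_pi_apply _) (fun j : I => t j) fun f => ?_
  rw [measureReal_def, measureReal_def]
  refine congrArg ENNReal.toReal ((hQ I (f.trans e) fun j => t j).trans ?_)
  congr 1
  ext x
  simp

end DeFinetti

/-! ### From frame automorphisms to exchangeability -/

/-- The extension property moves any finite tuple of distinct worlds of the proper cluster to any
other one. -/
lemma ExtensionProperty.exists_apply_eq {W : Type*} {R : W → W → Prop} {w₀ : W}
    (hext : ExtensionProperty R w₀) {J : Type*} [Finite J] (f g : J ↪ properCluster R w₀) :
    ∃ π ∈ worldStabilizer R w₀, ∀ j, π (f j) = g j := by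
  obtain ⟨m, ⟨e⟩⟩ := Finite.exists_equiv_fin J
  have hsub (h : J ↪ properCluster R w₀) (i : Fin m) :
      (({(h (e.symm i) : W)} : Finset W) : Set W) ⊆ properCluster R w₀ := by
    simp
  have hdisj (h : J ↪ properCluster R w₀) : Pairwise fun i j : Fin m =>
      Disjoint ({(h (e.symm i) : W)} : Finset W) {(h (e.symm j) : W)} := by
    intro i j hij
    rw [Finset.disjoint_singleton]
    exact fun heq => hij (e.symm.injective (h.injective (Subtype.ext heq)))
  -- Matching singletons prescribes the image of each world, not merely of a set.
  obtain ⟨π, hπ, h⟩ := hext m (fun i => {(f (e.symm i) : W)}) (fun i => {(g (e.symm i) : W)})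
    (hsub f) (hsub g) (hdisj f) (hdisj g) fun i => by simp
  refine ⟨π, hπ, fun j => ?_⟩
  simpa using h (e j)

theorem theorem1 {W L : Type*} [Countable W] [Finite L]
    (R : W → W → Prop) (hR : Equivalence R) (w₀ : W)
    (hinf : (accessibleCluster R w₀).Infinite)
    (hhom : PointHomogeneousAt R w₀)
    (hext : ExtensionProperty R w₀)
    (P : Measure (ValuationSpace W L)) [IsProbabilityMeasure P]
    (hP : ModallyExchangeable R w₀ P) :
    ∃ μ : Measure (ProbabilityMeasure (L → Bool)), IsProbabilityMeasure μ ∧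
      ∀ A : Set (ValuationSpace (properCluster R w₀) L), MeasurableSet A →
        Measurable (fun Λ => iidLaw (properCluster R w₀) Λ A) ∧
        P {V | (fun w : properCluster R w₀ => V w) ∈ A} =
          ∫⁻ Λ, iidLaw (properCluster R w₀) Λ A ∂μ := by
  classical
  have := Fintype.ofFinite (L → Bool)
  have : Infinite (properCluster R w₀) := (hinf.sdiff (Set.finite_singleton w₀)).to_subtype
  have hres : Measurable fun (V : ValuationSpace W L) (w : properCluster R w₀) => V w :=
    measurable_pi_lambda _ fun w => measurable_pi_apply _
  have hprob := Measure.isProbabilityMeasure_map (μ := P) hres.aemeasurable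
  have hmeas {I : Finset (properCluster R w₀)} (f : I → properCluster R w₀)
      (t : I → Set (L → Bool)) :
      MeasurableSet {x : ValuationSpace (properCluster R w₀) L | ∀ i, x (f i) ∈ t i} := by
    rw [Set.ofPred_forall]
    exact MeasurableSet.iInter fun i =>
      measurable_pi_apply (f i) (Set.toFinite (t i)).measurableSet
  obtain ⟨μ, hμ, h⟩ := exists_eq_bind_infinitePi_of_exchangeable
    (P.map fun V (w : properCluster R w₀) => V w) fun I f t => by
      rw [Measure.map_apply hres (hmeas f t), Measure.map_apply hres (hmeas Subtype.val t)]
      -- Since the action uses `π⁻¹`, `π` must send `f i` to `i` for `π · V` to take the value `V (f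
      -- i)` at `i`.
      obtain ⟨π, hπ, hfg⟩ := hext.exists_apply_eq f (Function.Embedding.subtype _)
      rw [← hP π hπ _ (hres (hmeas Subtype.val t))]
      congr 1
      ext V
      have hV (i : I) : actOnValuation π V ((i : properCluster R w₀) : W) = V (f i) := by
        change V (π.symm _) = _
        congr 1
        rw [RelIso.symm_apply_eq]
        exact (hfg i).symm
      exact forall_congr' fun i => by
        change V (f i) ∈ t i ↔ actOnValuation π V (i : properCluster R w₀) ∈ t i
        rw [hV]
  refine ⟨μ, hμ, fun A hA =>
    ⟨(Measure.measurable_coe hA).comp measurable_infinitePi_const, ?_⟩⟩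
  have hA' := DFunLike.congr_fun h A
  rw [Measure.map_apply hres hA,
    Measure.bind_apply hA measurable_infinitePi_const.aemeasurable] at hA'
  exact hA'
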